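/- Let $N\ge 1$ and $Q=(0,1)^N$. For $s\in(0,1)$ and a test function $\varphi\in C_c^\infty(Q)$ put $$\partial^s_{i,R}\varphi(x):=-\frac{1}{\Gamma(1-s)}\,\frac{d}{dy}\Big|_{y=x_i}\int_y^1\frac{\varphi(x_1,\dots,t,\dots,x_N)}{(t-y)^{s}}\,dt$$ ($t$ in the $i$-th position), and for $\varphi=(\varphi_1,\dots,\varphi_N)$ put $\operatorname{div}^s\varphi:=\big[(1-\tfrac1N)s+\tfrac1N\big]\sum_{i=1}^N\partial^s_{i,R}\varphi_i$. For $r>0$ non-integer, with integer part $\lfloor r\rfloor$ and fractional part $s=r-\lfloor r\rfloor\in(0,1)$, for $p\in[1,\infty]$ and $u\in L^1(Q)$, let $$TV^r_{\ell^p}(u):=\sup\Big\{\int_Q u\,\operatorname{div}^s[\operatorname{div}^{\lfloor r\rfloor}\varphi]\,dx:\ \varphi\in C_c^\infty(Q;\mathbb M^{N\times N^{\lfloor r\rfloor}}),\ |\varphi|^*_{\ell^p}\le 1\Big\}\in[0,\infty],$$ where $\operatorname{div}^{\lfloor r\rfloor}$ is the iterated (row-wise) classical divergence and $|\varphi|^*_{\ell^p}:=\sup_j\sup_x|\varphi_j(x)|_{\ell^{p^*}}$,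 $\tfrac1p+\tfrac1{p^*}=1$, the $\varphi_j$ being the $N^{\lfloor r\rfloor}$ rows of $\varphi$, with values in $\mathbb R^N$. Let $SV^r(Q)$ be the set of all $u\in L^1(Q)$ with the following property: for every $p\in[1,\infty]$ one has $TV^r_{\ell^p}(u)<\infty$ and there are $u_n\in C^\infty(Q)\cap L^1(Q)$ with $TV^r_{\ell^p}(u_n)<\infty$, $u_n\to u$ in $L^1(Q)$ and $TV^r_{\ell^p}(u_n)\to TV^r_{\ell^p}(u)$. Then for every integer $m\ge 0$ there is a constant $C>0$, depending only on $N$ and $m$, such that for every order $r=m+s$ with integer part $\lfloor r\rfloor=m$ and any fractional part $s\in(0,1)$, every $p\in[1,\infty]$ and every $u\in SV^r(Q)$, $$TV^s_{\ell^p}(u)\le C\big(\|u\|_{L^1(Q)}+TV^r_{\ell^p}(u)\big).$$ In particular, one constant serves all non-integer orders $r$ in any bounded range, and it does not degenerate as $s\to0$ or $s\to1$. -/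

import Mathlib

open MeasureTheory Filter Topology
open scoped ENNReal

noncomputable section

namespace RealOrderTV

/-- The open unit cube `Q = (0,1)^N`. -/
def cube (N : ℕ) : Set (Fin N → ℝ) := Set.univ.pi fun _ => Set.Ioo (0 : ℝ) 1

/-- Lebesgue measure on `Q`. -/
def cubeMeasure (N : ℕ) : Measure (Fin N → ℝ) := volume.restrict (cube N)

/-- Real-valued test functions: `C_c^∞(Q)`, extended by zero to `ℝ^N`. -/
def IsTestFunction {N : ℕ} (φ : (Fin N → ℝ) → ℝ) : Prop :=
  ContDiff ℝ (⊤ : ℕ∞) φ ∧ HasCompactSupport φ ∧ tsupport φ ⊆ cube N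

/-- A field on `ℝ^N` with `N^m` scalar components, indexed by the multi-indices of length `m`. -/
abbrev TensorField (N m : ℕ) : Type := (Fin m → Fin N) → (Fin N → ℝ) → ℝ

/-- The classical row-wise divergence: it contracts the last index of the field with `∂`. -/
def divergence {N m : ℕ} (φ : TensorField N (m + 1)) : TensorField N m :=
  fun J x => ∑ i : Fin N, fderiv ℝ (φ (Fin.snoc (α := fun _ => Fin N) J i)) x (Pi.single i 1)

/-- The iterated divergence `div^k`, from `N × N^k` fields to vector fields. -/
def iterDivergence {N : ℕ} : (k : ℕ) → TensorField N (k + 1) → TensorField N 1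
  | 0, φ => φ
  | k + 1, φ => iterDivergence k (divergence φ)

/-- The right-sided Riemann-Liouville partial derivative `∂^s_{i,R} φ` of order `s ∈ (0,1)` on the
unit cube:
`-1/Γ(1-s) * d/dy ∫_y^1 φ(x_1,…,t,…,x_N) (t-y)^(-s) dt` at `y = x_i`, with `t` in position `i`. -/
def rightPartial {N : ℕ} (s : ℝ) (i : Fin N) (φ : (Fin N → ℝ) → ℝ) (x : Fin N → ℝ) : ℝ :=
  -(1 / Real.Gamma (1 - s)) *
    deriv (fun y : ℝ => ∫ t in y..1, φ (Function.update x i t) / (t - y) ^ s) (x i)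

/-- The (scaled) fractional divergence
`div^s φ = [(1 - 1/N) s + 1/N] ∑_i ∂^s_{i,R} φ_i` of a vector field. -/
def fracDivergence {N : ℕ} (s : ℝ) (φ : TensorField N 1) (x : Fin N → ℝ) : ℝ :=
  ((1 - 1 / (N : ℝ)) * s + 1 / (N : ℝ)) *
    ∑ i : Fin N, rightPartial s i (φ fun _ => i) x

/-- The test fields `φ ∈ C_c^∞(Q; M^{N × N^k})` with `|φ|*_{ℓ^p} ≤ 1`: each of the `N^k` components
`φ_J`, which is a vector field with values in `ℝ^N`, has `ℓ^{p*}`-norm at most `1` at every point,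
where `1/p + 1/p* = 1`. -/
def IsAdmissible {N : ℕ} (p : ℝ≥0∞) (k : ℕ) (φ : TensorField N (k + 1)) : Prop :=
  (∀ J, IsTestFunction (φ J)) ∧
    ∀ (J : Fin k → Fin N) (x : Fin N → ℝ),
      ‖WithLp.toLp p.conjExponent
        (fun i : Fin N => φ (Fin.snoc (α := fun _ => Fin N) J i) x)‖ ≤ 1

/-- The supremum of `∫_Q u div^s[div^k φ] dx` over the admissible test fields. As `φ = 0` is
admissible, this supremum is nonnegative, and it may be `∞`. -/
def variation {N : ℕ} (p : ℝ≥0∞) (k : ℕ) (s : ℝ) (u : (Fin N → ℝ) → ℝ) : ℝ≥0∞ :=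
  ⨆ (φ : TensorField N (k + 1)) (_ : IsAdmissible p k φ),
    ENNReal.ofReal (∫ x, u x * fracDivergence s (iterDivergence k φ) x ∂(cubeMeasure N))

/-- The `r`-order total variation `TV^r_{ℓ^p}(u)` on `Q`, for a non-integer order `r > 0` with integer
part `⌊r⌋` and fractional part `s = r - ⌊r⌋ ∈ (0,1)`. -/
def TV {N : ℕ} (p : ℝ≥0∞) (r : ℝ) (u : (Fin N → ℝ) → ℝ) : ℝ≥0∞ :=
  variation p ⌊r⌋₊ (Int.fract r) u

/-- `‖u‖_{L^1(Q)}`. -/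
def normL1 {N : ℕ} (u : (Fin N → ℝ) → ℝ) : ℝ≥0∞ := eLpNorm u 1 (cubeMeasure N)

/-- Strict convergence `u_n → u` with respect to `TV^r_{ℓ^p}`: convergence in `L^1(Q)` together with
`|TV^r(u_n) - TV^r(u)| → 0`, all the total variations being finite. -/
def StrictConv {N : ℕ} (p : ℝ≥0∞) (r : ℝ) (v : ℕ → (Fin N → ℝ) → ℝ)
    (u : (Fin N → ℝ) → ℝ) : Prop :=
  (∀ n, MemLp (v n) 1 (cubeMeasure N) ∧ TV p r (v n) < ∞) ∧
    MemLp u 1 (cubeMeasure N) ∧ TV p r u < ∞ ∧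
    Tendsto (fun n => normL1 (u - v n)) atTop (𝓝 0) ∧
    Tendsto (fun n => TV p r (v n)) atTop (𝓝 (TV p r u))

/-- The space `SV^r(Q)`: for every `p ∈ [1,∞]`, the function is the strict limit with respect to
`TV^r_{ℓ^p}` of a sequence in `C^∞(Q)`, where `Q` is the open cube. -/
def SV (N : ℕ) (r : ℝ) : Set ((Fin N → ℝ) → ℝ) :=
  {u | ∀ p : ℝ≥0∞, 1 ≤ p → ∃ v : ℕ → (Fin N → ℝ) → ℝ,
    (∀ n, ContDiffOn ℝ (⊤ : ℕ∞) (v n) (cube N)) ∧ StrictConv p r v u}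

end RealOrderTV

end

/-! For `m = 0` both variations coincide. For `m ≥ 1`, let `φ` be an admissible vector field, so
that each component is bounded by 1. The core is the decomposition `φ_i = ∂_i^m ψ_i + ρ_i` into test
functions with `|ψ_i| ≤ A` and `|∂_i ρ_i| ≤ B`, where `A`, `B` depend on `m` only
(`exists_eq_iterate_partialDeriv_add`). It comes from subtracting, in the variable `x_i`, a bump
times the mean and integrating, `m` times over.

The tensor with `ψ_i / A` at the index `(i,…,i)` and zeros elsewhere has at most one nonzero entry
per row, so it is admissible for every `p`, and its iterated divergence has components `∂_i^m ψ_i /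
A`. Thus `∫ u div^s φ` is `A` times a competitor for `TV^r(u)` plus `∫ u div^s ρ`. The last term is
at most `N B ‖u‖_1 / Γ(2-s)` once the fractional derivative is in Caputo form, and `1 / Γ(2-s)` is
bounded on `(0,1)`. Hence the constant is uniform in `s` and `p`. -/

namespace RealOrderTV

/-! ### Smoothness of integrals depending on a parameter. -/

section ParametricIntegral

variable {E : Type*} [NormedAddCommGroup E] [NormedSpace ℝ E]

theorem hasFDerivAt_intervalIntegral_param [ProperSpace E] {G : E × ℝ → ℝ} (hG : ContDiff ℝ 1 G)
    (a b : ℝ) (x : E) :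
    HasFDerivAt (fun y => ∫ t in a..b, G (y, t))
      (∫ t in a..b, (fderiv ℝ G (x, t)).comp (ContinuousLinearMap.inl ℝ E ℝ)) x := by
  have hc : Continuous fun q : E × ℝ =>
      (fderiv ℝ G q).comp (ContinuousLinearMap.inl ℝ E ℝ) :=
    (hG.continuous_fderiv one_ne_zero).clm_comp continuous_const
  obtain ⟨B, hB⟩ := ((isCompact_closedBall x 1).prod (isCompact_uIcc (a := a) (b := b))).exists_bound_of_continuousOn
    hc.continuousOn
  refine (intervalIntegral.hasFDerivAt_integral_of_dominated_of_fderiv_le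
    (F := fun y t => G (y, t))
    (F' := fun y t => (fderiv ℝ G (y, t)).comp (ContinuousLinearMap.inl ℝ E ℝ))
    (s := Metric.closedBall x 1) (bound := fun _ => B)
    (Metric.closedBall_mem_nhds x one_pos) ?_ ?_ ?_ ?_ ?_ ?_)
  · exact Eventually.of_forall fun y =>
      (hG.continuous.comp (by fun_prop : Continuous fun t : ℝ => (y, t))).aestronglyMeasurable
  · exact (hG.continuous.comp (by fun_prop : Continuous fun t : ℝ => (x, t))).intervalIntegrable _ _
  · exact (hc.comp (by fun_prop : Continuous fun t : ℝ => (x, t))).aestronglyMeasurable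
  · exact Eventually.of_forall fun t ht y hy => hB (y, t) ⟨hy, Set.uIoc_subset_uIcc ht⟩
  · exact intervalIntegrable_const
  · refine Eventually.of_forall fun t _ y _ => ?_
    exact ((hG.differentiable one_ne_zero (y, t)).hasFDerivAt).comp y (hasFDerivAt_prodMk_left y t)

theorem fderiv_intervalIntegral_param [ProperSpace E] {G : E × ℝ → ℝ} (hG : ContDiff ℝ 1 G)
    (a b : ℝ) (x v : E) :
    fderiv ℝ (fun y => ∫ t in a..b, G (y, t)) x v = ∫ t in a..b, fderiv ℝ G (x, t) (v, 0) := by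
  rw [(hasFDerivAt_intervalIntegral_param hG a b x).fderiv,
    ContinuousLinearMap.intervalIntegral_apply]
  · simp
  · exact ((((hG.continuous_fderiv one_ne_zero).clm_comp continuous_const)).comp
      (by fun_prop : Continuous fun t : ℝ => (x, t))).intervalIntegrable _ _

/-- Each directional derivative of the integral is again such an integral, of a directional
derivative of `G`; hence the induction on the order with `G` generalized. -/
theorem contDiff_intervalIntegral_param [FiniteDimensional ℝ E] {G : E × ℝ → ℝ}
    (hG : ContDiff ℝ (⊤ : ℕ∞) G) (a b : ℝ) :
    ContDiff ℝ (⊤ : ℕ∞) fun y => ∫ t in a..b, G (y, t) := by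
  have : ProperSpace E := FiniteDimensional.proper ℝ E
  rw [contDiff_infty]
  intro n
  induction n generalizing G with
  | zero =>
    rw [Nat.cast_zero, contDiff_zero]
    exact continuous_iff_continuousAt.2 fun x =>
      (hasFDerivAt_intervalIntegral_param (hG.of_le (by exact_mod_cast le_top)) a b x).continuousAt
  | succ n ih =>
    have h1 : ContDiff ℝ 1 G := hG.of_le (by exact_mod_cast le_top)
    rw [Nat.cast_succ, contDiff_succ_iff_fderiv_apply]
    refine ⟨fun x => (hasFDerivAt_intervalIntegral_param h1 a b x).differentiableAt, by simp,
      fun v => ?_⟩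
    simp only [fderiv_intervalIntegral_param h1]
    exact ih (G := fun q => fderiv ℝ G q (v, 0))
      ((hG.fderiv_right (m := (⊤ : ℕ∞)) (by simp)).clm_apply contDiff_const)

end ParametricIntegral

/-! ### Test functions and their classical partial derivatives. -/

section TestFunction

variable {N : ℕ}

/-- A compact support keeps a positive distance from the faces of the cube. This coordinatewise form
survives integration in a single variable, which is how supports are controlled below. -/
theorem isTestFunction_iff {φ : (Fin N → ℝ) → ℝ} :
    IsTestFunction φ ↔ ContDiff ℝ (⊤ : ℕ∞) φ ∧
      ∃ ε > 0, ∀ x, φ x ≠ 0 → ∀ j, x j ∈ Set.Icc ε (1 - ε) := by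
  constructor
  · rintro ⟨h1, h2, h3⟩
    refine ⟨h1, ?_⟩
    have key : ∀ j : Fin N, ∃ ε > 0, ∀ x ∈ tsupport φ, x j ∈ Set.Icc ε (1 - ε) := by
      intro j
      rcases (tsupport φ).eq_empty_or_nonempty with he | hne
      · exact ⟨1, one_pos, by simp [he]⟩
      have hc : IsCompact (tsupport φ) := h2
      have hcont : Continuous fun x : Fin N → ℝ => min (x j) (1 - x j) := by fun_prop
      obtain ⟨z, hz, hmin⟩ := hc.exists_isMinOn hne hcont.continuousOn
      have hzj := h3 hz j (Set.mem_univ j)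
      refine ⟨min (z j) (1 - z j), lt_min hzj.1 (by linarith [hzj.2]), fun x hx => ?_⟩
      have : min (z j) (1 - z j) ≤ min (x j) (1 - x j) := hmin hx
      have h4 := this.trans (min_le_left _ _)
      have h5 := this.trans (min_le_right _ _)
      exact ⟨h4, by linarith⟩
    choose ε hε hsub using key
    rcases isEmpty_or_nonempty (Fin N) with hN | hN
    · exact ⟨1, one_pos, fun x _ j => (hN.false j).elim⟩
    refine ⟨Finset.univ.inf' Finset.univ_nonempty ε, (Finset.lt_inf'_iff _).2 fun j _ => hε j,
      fun x hx j => ?_⟩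
    have hj := hsub j x (subset_tsupport φ hx)
    have hle : Finset.univ.inf' Finset.univ_nonempty ε ≤ ε j :=
      Finset.inf'_le _ (Finset.mem_univ j)
    exact ⟨hle.trans hj.1, by linarith [hj.2]⟩
  · rintro ⟨h1, ε, hε, h2⟩
    have hsub : tsupport φ ⊆ Set.univ.pi fun _ => Set.Icc ε (1 - ε) :=
      closure_minimal (fun x hx j _ => h2 x hx j) (isClosed_set_pi fun _ _ => isClosed_Icc)
    refine ⟨h1, ?_, hsub.trans (Set.pi_mono fun j _ => ?_)⟩
    · exact (isCompact_univ_pi fun _ => isCompact_Icc).of_isClosed_subset (isClosed_tsupport φ) hsub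
    · exact Set.Icc_subset_Ioo hε (by linarith)

theorem IsTestFunction.differentiable {φ : (Fin N → ℝ) → ℝ} (h : IsTestFunction φ) :
    Differentiable ℝ φ := h.1.differentiable (by simp)

theorem isTestFunction_zero : IsTestFunction (0 : (Fin N → ℝ) → ℝ) :=
  isTestFunction_iff.2 ⟨contDiff_const, 1, one_pos, by simp⟩

theorem IsTestFunction.add {φ ψ : (Fin N → ℝ) → ℝ} (hφ : IsTestFunction φ)
    (hψ : IsTestFunction ψ) : IsTestFunction (φ + ψ) := by
  refine ⟨hφ.1.add hψ.1, hφ.2.1.add hψ.2.1, ?_⟩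
  exact (tsupport_add φ ψ).trans (Set.union_subset hφ.2.2 hψ.2.2)

theorem IsTestFunction.const_smul {φ : (Fin N → ℝ) → ℝ} (hφ : IsTestFunction φ) (c : ℝ) :
    IsTestFunction (c • φ) := by
  obtain ⟨h1, ε, hε, h⟩ := isTestFunction_iff.1 hφ
  refine isTestFunction_iff.2 ⟨contDiff_const.smul h1, ε, hε, fun x hx => h x fun h0 => hx ?_⟩
  simp [h0]

/-- The classical partial derivative `∂_i φ`. -/
noncomputable def partialDeriv (i : Fin N) (φ : (Fin N → ℝ) → ℝ) (x : Fin N → ℝ) : ℝ :=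
  fderiv ℝ φ x (Pi.single i 1)

theorem partialDeriv_zero (i : Fin N) : partialDeriv i 0 = 0 := by
  ext x
  simp [partialDeriv]

theorem partialDeriv_add {φ ψ : (Fin N → ℝ) → ℝ} (i : Fin N) (hφ : IsTestFunction φ)
    (hψ : IsTestFunction ψ) :
    partialDeriv i (φ + ψ) = partialDeriv i φ + partialDeriv i ψ := by
  ext x
  simp [partialDeriv, fderiv_add (hφ.differentiable x) (hψ.differentiable x)]

theorem partialDeriv_const_smul {φ : (Fin N → ℝ) → ℝ} (i : Fin N) (c : ℝ) :
    partialDeriv i (c • φ) = c • partialDeriv i φ := by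
  ext x
  simp [partialDeriv, fderiv_const_smul_field]

theorem IsTestFunction.partialDeriv {φ : (Fin N → ℝ) → ℝ} (hφ : IsTestFunction φ) (i : Fin N) :
    IsTestFunction (partialDeriv i φ) := by
  have hsub : tsupport (RealOrderTV.partialDeriv i φ) ⊆ tsupport φ :=
    closure_minimal (fun x hx => support_fderiv_subset ℝ (f := φ) fun h0 => hx (by
      simp [RealOrderTV.partialDeriv, h0])) (isClosed_tsupport φ)
  exact ⟨(hφ.1.fderiv_right (m := (⊤ : ℕ∞)) (by simp)).clm_apply contDiff_const,
    hφ.2.1.of_isClosed_subset (isClosed_tsupport _) hsub, hsub.trans hφ.2.2⟩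

theorem IsTestFunction.iterate_partialDeriv {φ : (Fin N → ℝ) → ℝ} (hφ : IsTestFunction φ)
    (i : Fin N) (k : ℕ) : IsTestFunction ((RealOrderTV.partialDeriv i)^[k] φ) := by
  induction k with
  | zero => exact hφ
  | succ k ih =>
    rw [Function.iterate_succ_apply']
    exact ih.partialDeriv i

theorem iterate_partialDeriv_add {φ ψ : (Fin N → ℝ) → ℝ} (i : Fin N) (hφ : IsTestFunction φ)
    (hψ : IsTestFunction ψ) (k : ℕ) :
    (partialDeriv i)^[k] (φ + ψ) = (partialDeriv i)^[k] φ + (partialDeriv i)^[k] ψ := by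
  induction k with
  | zero => rfl
  | succ k ih =>
    simp only [Function.iterate_succ_apply', ih]
    exact partialDeriv_add i (hφ.iterate_partialDeriv i k) (hψ.iterate_partialDeriv i k)

theorem iterate_partialDeriv_const_smul {φ : (Fin N → ℝ) → ℝ} (i : Fin N) (c : ℝ) (k : ℕ) :
    (partialDeriv i)^[k] (c • φ) = c • (partialDeriv i)^[k] φ := by
  induction k with
  | zero => rfl
  | succ k ih => simp only [Function.iterate_succ_apply', ih, partialDeriv_const_smul]

theorem hasDerivAt_update_comp {φ : (Fin N → ℝ) → ℝ} (hφ : Differentiable ℝ φ) (i : Fin N)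
    (x : Fin N → ℝ) (t : ℝ) :
    HasDerivAt (fun y => φ (Function.update x i y)) (partialDeriv i φ (Function.update x i t)) t :=
  (hφ _).hasFDerivAt.comp_hasDerivAt t (hasDerivAt_update x i t)

theorem IsTestFunction.exists_abs_le {φ : (Fin N → ℝ) → ℝ} (hφ : IsTestFunction φ) :
    ∃ B, ∀ x, |φ x| ≤ B := by
  obtain ⟨B, hB⟩ := hφ.2.1.exists_bound_of_continuous hφ.1.continuous
  exact ⟨B, hB⟩

end TestFunction

/-! ### Caputo form of the fractional divergence and bounds uniform in `s`. -/

section FractionalDerivative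

variable {N : ℕ}

theorem intervalIntegrable_div_rpow {h : ℝ → ℝ} (hh : Continuous h) {s : ℝ} (hs : s < 1) {a b : ℝ}
    (ha : 0 ≤ a) (hb : 0 ≤ b) : IntervalIntegrable (fun t => h t / t ^ s) volume a b := by
  have h1 : IntervalIntegrable (fun t : ℝ => h t * t ^ (-s)) volume a b :=
    (intervalIntegral.intervalIntegrable_rpow' (by linarith)).continuousOn_mul hh.continuousOn
  refine h1.congr fun t ht => ?_
  have ht0 : 0 ≤ t := (le_min ha hb).trans ht.1.le
  simp only [Real.rpow_neg ht0, div_eq_mul_inv]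

theorem integral_one_div_rpow {s : ℝ} (hs : s < 1) :
    ∫ t in (0 : ℝ)..1, 1 / t ^ s = 1 / (1 - s) := by
  have h1 : ∫ t in (0 : ℝ)..1, 1 / t ^ s = ∫ t in (0 : ℝ)..1, t ^ (-s) := by
    refine intervalIntegral.integral_congr fun t ht => ?_
    rw [Set.uIcc_of_le zero_le_one] at ht
    simp only [Real.rpow_neg ht.1, one_div]
  rw [h1, integral_rpow (Or.inl (by linarith))]
  have : -s + 1 ≠ 0 := by linarith
  rw [Real.one_rpow, Real.zero_rpow this, sub_zero, neg_add_eq_sub]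

/-- The right-sided fractional derivative with the classical derivative moved onto `φ`
(Caputo form), the integral running over the fixed interval `(0,1)`. -/
noncomputable def caputoPartial (s : ℝ) (i : Fin N) (φ : (Fin N → ℝ) → ℝ) (x : Fin N → ℝ) : ℝ :=
  -(1 / Real.Gamma (1 - s)) *
    ∫ τ in (0 : ℝ)..1, partialDeriv i φ (Function.update x i (x i + τ)) / τ ^ s

/-- Translation by `y` gives the upper limit `1 - y`, which can be raised to `1` because `g`
vanishes beyond `1`. The singular kernel then no longer depends on `y`. -/
theorem integral_div_rpow_eq {g : ℝ → ℝ} (hg : Continuous g) (hg1 : ∀ t, 1 ≤ t → g t = 0) {s : ℝ}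
    (hs : s < 1) {y : ℝ} (hy : y ∈ Set.Ioo (0 : ℝ) 1) :
    ∫ t in y..1, g t / (t - y) ^ s = ∫ τ in (0 : ℝ)..1, g (y + τ) / τ ^ s := by
  have h1 := intervalIntegral.integral_comp_add_left (a := 0) (b := 1 - y)
    (fun t => g t / (t - y) ^ s) y
  simp only [add_zero, add_sub_cancel, add_sub_cancel_left] at h1
  rw [← h1]
  have hc : Continuous fun τ => g (y + τ) := by fun_prop
  rw [← intervalIntegral.integral_add_adjacent_intervals
    (intervalIntegrable_div_rpow hc hs le_rfl (b := 1 - y) (by linarith [hy.2]))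
    (intervalIntegrable_div_rpow hc hs (by linarith [hy.2]) zero_le_one)]
  have h2 : ∫ τ in (1 - y)..1, g (y + τ) / τ ^ s = ∫ τ in (1 - y)..1, (0 : ℝ) := by
    refine intervalIntegral.integral_congr fun τ hτ => ?_
    rw [Set.uIcc_of_le (by linarith [hy.1])] at hτ
    simp only [hg1 (y + τ) (by linarith [hτ.1]), zero_div]
  rw [h2, intervalIntegral.integral_zero, add_zero]

theorem IsTestFunction.eq_zero_of_not_mem {φ : (Fin N → ℝ) → ℝ} (hφ : IsTestFunction φ)
    {x : Fin N → ℝ} (hx : x ∉ cube N) : φ x = 0 :=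
  image_eq_zero_of_notMem_tsupport fun h => hx (hφ.2.2 h)

/-- With the kernel fixed, one differentiates under the integral; the dominating function `B / τ^s`
is integrable since `s < 1`. -/
theorem rightPartial_eq_caputoPartial {φ : (Fin N → ℝ) → ℝ} (hφ : IsTestFunction φ) {s : ℝ}
    (hs : s < 1) (i : Fin N) {x : Fin N → ℝ} (hx : x ∈ cube N) :
    rightPartial s i φ x = caputoPartial s i φ x := by
  have hxi : x i ∈ Set.Ioo (0 : ℝ) 1 := hx i (Set.mem_univ i)
  have hcu : Continuous fun t : ℝ => Function.update x i t := continuous_const.update i continuous_id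
  have hg : Continuous fun t => φ (Function.update x i t) := hφ.1.continuous.comp hcu
  have hg' : Continuous fun t => partialDeriv i φ (Function.update x i t) :=
    (hφ.partialDeriv i).1.continuous.comp hcu
  have hg1 : ∀ t, 1 ≤ t → φ (Function.update x i t) = 0 := fun t ht =>
    hφ.eq_zero_of_not_mem fun h => by
      have := h i (Set.mem_univ i)
      rw [Function.update_self] at this
      linarith [this.2]
  obtain ⟨B, hB⟩ := (hφ.partialDeriv i).exists_abs_le
  have hev : (fun y : ℝ => ∫ t in y..1, φ (Function.update x i t) / (t - y) ^ s) =ᶠ[𝓝 (x i)]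
      fun y => ∫ τ in (0 : ℝ)..1, φ (Function.update x i (y + τ)) / τ ^ s := by
    filter_upwards [Ioo_mem_nhds hxi.1 hxi.2] with y hy
    exact integral_div_rpow_eq hg hg1 hs hy
  have hderiv : HasDerivAt (fun y => ∫ τ in (0 : ℝ)..1, φ (Function.update x i (y + τ)) / τ ^ s)
      (∫ τ in (0 : ℝ)..1, partialDeriv i φ (Function.update x i (x i + τ)) / τ ^ s) (x i) := by
    refine (intervalIntegral.hasDerivAt_integral_of_dominated_loc_of_deriv_le
      (F := fun y τ => φ (Function.update x i (y + τ)) / τ ^ s)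
      (F' := fun y τ => partialDeriv i φ (Function.update x i (y + τ)) / τ ^ s)
      (s := Set.univ) (bound := fun τ => B / τ ^ s) univ_mem ?_ ?_ ?_ ?_ ?_ ?_).2
    · exact Eventually.of_forall fun y => (intervalIntegrable_iff.1 (intervalIntegrable_div_rpow
        (hg.comp (continuous_const_add y)) hs le_rfl zero_le_one)).aestronglyMeasurable
    · exact intervalIntegrable_div_rpow (hg.comp (continuous_const_add _)) hs le_rfl zero_le_one
    · exact (intervalIntegrable_iff.1 (intervalIntegrable_div_rpow
        (hg'.comp (continuous_const_add _)) hs le_rfl zero_le_one)).aestronglyMeasurable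
    · refine Eventually.of_forall fun τ hτ y _ => ?_
      rw [Set.uIoc_of_le zero_le_one] at hτ
      rw [Real.norm_eq_abs, abs_div, abs_of_nonneg (Real.rpow_nonneg hτ.1.le s)]
      exact div_le_div_of_nonneg_right (hB _) (Real.rpow_nonneg hτ.1.le s)
    · exact intervalIntegrable_div_rpow continuous_const hs le_rfl zero_le_one
    · refine Eventually.of_forall fun τ _ y _ => ?_
      exact ((hasDerivAt_update_comp hφ.differentiable i x (y + τ)).comp_add_const y τ).div_const _
  rw [rightPartial, caputoPartial, hev.deriv_eq, hderiv.deriv]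

theorem continuous_update_add (i : Fin N) (τ : ℝ) :
    Continuous fun x : Fin N → ℝ => Function.update x i (x i + τ) :=
  continuous_id.update i (by fun_prop)

theorem intervalIntegrable_caputo {φ : (Fin N → ℝ) → ℝ} (hφ : IsTestFunction φ) {s : ℝ}
    (hs : s < 1) (i : Fin N) (x : Fin N → ℝ) :
    IntervalIntegrable (fun τ => partialDeriv i φ (Function.update x i (x i + τ)) / τ ^ s)
      volume 0 1 :=
  intervalIntegrable_div_rpow ((hφ.partialDeriv i).1.continuous.comp
    (continuous_const.update i (by fun_prop))) hs le_rfl zero_le_one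

/-- The kernel has mass `1 / (1 - s)`, which blows up as `s → 1`; the prefactor absorbs it through
`(1 - s) Γ(1 - s) = Γ(2 - s)`. -/
theorem abs_caputoPartial_le {φ : (Fin N → ℝ) → ℝ} {s : ℝ}
    (hs : s < 1) (i : Fin N) {B : ℝ} (hB : ∀ x, |partialDeriv i φ x| ≤ B) (x : Fin N → ℝ) :
    |caputoPartial s i φ x| ≤ B / Real.Gamma (2 - s) := by
  have hΓ : 0 < Real.Gamma (1 - s) := Real.Gamma_pos_of_pos (by linarith)
  have h2 : Real.Gamma (2 - s) = (1 - s) * Real.Gamma (1 - s) := by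
    rw [← Real.Gamma_add_one (by linarith)]
    congr 1
    ring
  have h3 : |∫ τ in (0 : ℝ)..1, partialDeriv i φ (Function.update x i (x i + τ)) / τ ^ s| ≤
      B / (1 - s) := by
    have h4 : ∫ τ in (0 : ℝ)..1, B / τ ^ s = B / (1 - s) := by
      have := integral_one_div_rpow hs
      simp only [div_eq_mul_inv B, intervalIntegral.integral_const_mul]
      simp only [one_div] at this
      rw [this]
    rw [← h4, ← Real.norm_eq_abs]
    refine intervalIntegral.norm_integral_le_of_norm_le zero_le_one
      (Eventually.of_forall fun τ hτ => ?_)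
      (intervalIntegrable_div_rpow continuous_const hs le_rfl zero_le_one)
    rw [Real.norm_eq_abs, abs_div, abs_of_nonneg (Real.rpow_nonneg hτ.1.le s)]
    exact div_le_div_of_nonneg_right (hB _) (Real.rpow_nonneg hτ.1.le s)
  rw [caputoPartial, abs_mul, abs_neg, abs_of_pos (one_div_pos.2 hΓ), h2]
  calc 1 / Real.Gamma (1 - s) * _ ≤ 1 / Real.Gamma (1 - s) * (B / (1 - s)) :=
        mul_le_mul_of_nonneg_left h3 (one_div_pos.2 hΓ).le
    _ = B / ((1 - s) * Real.Gamma (1 - s)) := by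
        rw [div_mul_div_comm, one_mul, mul_comm (1 - s)]

theorem exists_one_div_Gamma_le :
    ∃ K > 0, ∀ s ∈ Set.Ioo (0 : ℝ) 1, 1 / Real.Gamma (2 - s) ≤ K := by
  have hpos : ∀ s ∈ Set.Icc (0 : ℝ) 1, 0 < Real.Gamma (2 - s) := fun s hs =>
    Real.Gamma_pos_of_pos (by linarith [hs.2])
  have hc : ContinuousOn (fun s : ℝ => 1 / Real.Gamma (2 - s)) (Set.Icc 0 1) := by
    intro s hs
    refine ContinuousAt.continuousWithinAt (ContinuousAt.div continuousAt_const ?_ (hpos s hs).ne')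
    refine ContinuousAt.comp' (g := Real.Gamma) ?_ (by fun_prop)
    refine (Real.differentiableAt_Gamma fun n h => ?_).continuousAt
    have : (0 : ℝ) ≤ n := n.cast_nonneg
    linarith [hs.2]
  obtain ⟨K, hK⟩ := isCompact_Icc.exists_bound_of_continuousOn hc
  refine ⟨max K 1, lt_max_of_lt_right one_pos, fun s hs => ?_⟩
  exact (le_abs_self _).trans ((hK s (Set.Ioo_subset_Icc_self hs)).trans (le_max_left _ _))

theorem continuous_caputoPartial {φ : (Fin N → ℝ) → ℝ} (hφ : IsTestFunction φ) {s : ℝ}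
    (hs : s < 1) (i : Fin N) : Continuous (caputoPartial s i φ) := by
  obtain ⟨B, hB⟩ := (hφ.partialDeriv i).exists_abs_le
  refine continuous_const.mul ?_
  refine intervalIntegral.continuous_of_dominated_interval (bound := fun τ => B / τ ^ s)
    (fun x => (intervalIntegrable_iff.1 (intervalIntegrable_caputo hφ hs i x)).aestronglyMeasurable)
    (fun x => Eventually.of_forall fun τ hτ => ?_)
    (intervalIntegrable_div_rpow continuous_const hs le_rfl zero_le_one)
    (Eventually.of_forall fun τ _ => ?_)
  · rw [Set.uIoc_of_le zero_le_one] at hτ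
    rw [Real.norm_eq_abs, abs_div, abs_of_nonneg (Real.rpow_nonneg hτ.1.le s)]
    exact div_le_div_of_nonneg_right (hB _) (Real.rpow_nonneg hτ.1.le s)
  · exact ((hφ.partialDeriv i).1.continuous.comp (continuous_update_add i τ)).div_const _

theorem caputoPartial_add {φ ψ : (Fin N → ℝ) → ℝ} (hφ : IsTestFunction φ)
    (hψ : IsTestFunction ψ) {s : ℝ} (hs : s < 1) (i : Fin N) (x : Fin N → ℝ) :
    caputoPartial s i (φ + ψ) x = caputoPartial s i φ x + caputoPartial s i ψ x := by
  simp only [caputoPartial, partialDeriv_add i hφ hψ, Pi.add_apply, add_div]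
  rw [intervalIntegral.integral_add (intervalIntegrable_caputo hφ hs i x)
    (intervalIntegrable_caputo hψ hs i x), mul_add]

theorem caputoPartial_const_smul {φ : (Fin N → ℝ) → ℝ} (c s : ℝ) (i : Fin N) (x : Fin N → ℝ) :
    caputoPartial s i (c • φ) x = c * caputoPartial s i φ x := by
  simp only [caputoPartial, partialDeriv_const_smul, Pi.smul_apply, smul_eq_mul, mul_div_assoc,
    intervalIntegral.integral_const_mul]
  ring

/-- The fractional divergence in Caputo form. -/
noncomputable def caputoDivergence (s : ℝ) (φ : TensorField N 1) (x : Fin N → ℝ) : ℝ :=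
  ((1 - 1 / (N : ℝ)) * s + 1 / (N : ℝ)) * ∑ i : Fin N, caputoPartial s i (φ fun _ => i) x

theorem fracDivergence_eq_caputoDivergence {φ : TensorField N 1} (hφ : ∀ J, IsTestFunction (φ J))
    {s : ℝ} (hs : s < 1) {x : Fin N → ℝ} (hx : x ∈ cube N) :
    fracDivergence s φ x = caputoDivergence s φ x := by
  simp only [fracDivergence, caputoDivergence, rightPartial_eq_caputoPartial (hφ _) hs _ hx]

theorem continuous_caputoDivergence {φ : TensorField N 1} (hφ : ∀ J, IsTestFunction (φ J))
    {s : ℝ} (hs : s < 1) : Continuous (caputoDivergence s φ) :=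
  continuous_const.mul (continuous_finsetSum _ fun i _ => continuous_caputoPartial (hφ _) hs i)

theorem caputoDivergence_add {φ ψ : TensorField N 1} (hφ : ∀ J, IsTestFunction (φ J))
    (hψ : ∀ J, IsTestFunction (ψ J)) {s : ℝ} (hs : s < 1) (x : Fin N → ℝ) :
    caputoDivergence s (φ + ψ) x = caputoDivergence s φ x + caputoDivergence s ψ x := by
  simp only [caputoDivergence, Pi.add_apply φ ψ, caputoPartial_add (hφ _) (hψ _) hs,
    Finset.sum_add_distrib, mul_add]

theorem caputoDivergence_const_smul (c s : ℝ) (φ : TensorField N 1) (x : Fin N → ℝ) :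
    caputoDivergence s (c • φ) x = c * caputoDivergence s φ x := by
  simp only [caputoDivergence, Pi.smul_apply c φ, caputoPartial_const_smul, ← Finset.mul_sum]
  ring

theorem abs_caputoDivergence_le {φ : TensorField N 1} {s : ℝ} (hs : s ∈ Set.Ioo (0 : ℝ) 1) {B : ℝ}
    (hB : ∀ i x, |partialDeriv i (φ fun _ => i) x| ≤ B) (x : Fin N → ℝ) :
    |caputoDivergence s φ x| ≤ N * (B / Real.Gamma (2 - s)) := by
  have hN0 : 0 ≤ 1 / (N : ℝ) := by positivity
  have hN1 : 1 / (N : ℝ) ≤ 1 := by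
    rcases Nat.eq_zero_or_pos N with h | h
    -- For `N = 0` the convention `1 / 0 = 0` applies.
    · simp [h]
    · exact (div_le_one (by positivity)).2 (by exact_mod_cast h)
  have hc0 : 0 ≤ (1 - 1 / (N : ℝ)) * s + 1 / (N : ℝ) :=
    -- The scaling factor is the convex combination `s · 1 + (1 - s) · (1/N)`, so it lies in
    -- `[0,1]`.
    add_nonneg (mul_nonneg (by linarith) hs.1.le) hN0
  have hc1 : (1 - 1 / (N : ℝ)) * s + 1 / (N : ℝ) ≤ 1 := by nlinarith [hs.2]
  have hsum : |∑ i : Fin N, caputoPartial s i (φ fun _ => i) x| ≤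
      N * (B / Real.Gamma (2 - s)) := by
    refine (Finset.abs_sum_le_sum_abs _ _).trans ?_
    refine (Finset.sum_le_sum fun i _ => abs_caputoPartial_le hs.2 i (hB i) x).trans ?_
    simp
  rw [caputoDivergence, abs_mul, abs_of_nonneg hc0]
  exact (mul_le_of_le_one_left (abs_nonneg _) hc1).trans hsum

theorem measurableSet_cube : MeasurableSet (cube N) :=
  MeasurableSet.univ_pi fun _ => measurableSet_Ioo

theorem exists_abs_caputoDivergence_le {φ : TensorField N 1} (hφ : ∀ J, IsTestFunction (φ J))
    {s : ℝ} (hs : s ∈ Set.Ioo (0 : ℝ) 1) : ∃ B, ∀ x, |caputoDivergence s φ x| ≤ B := by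
  have h : ∀ i : Fin N, ∃ B, ∀ x, |partialDeriv i (φ fun _ => i) x| ≤ B :=
    fun i => ((hφ _).partialDeriv i).exists_abs_le
  choose B hB using h
  refine ⟨_, abs_caputoDivergence_le hs (B := ∑ i, |B i|) fun i x => ?_⟩
  exact (hB i x).trans ((le_abs_self _).trans
    (Finset.single_le_sum (f := fun i => |B i|) (fun _ _ => abs_nonneg _) (Finset.mem_univ i)))

theorem integrable_mul_caputoDivergence {u : (Fin N → ℝ) → ℝ} (hu : MemLp u 1 (cubeMeasure N))
    {φ : TensorField N 1} (hφ : ∀ J, IsTestFunction (φ J)) {s : ℝ} (hs : s ∈ Set.Ioo (0 : ℝ) 1) :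
    Integrable (fun x => u x * caputoDivergence s φ x) (cubeMeasure N) := by
  obtain ⟨B, hB⟩ := exists_abs_caputoDivergence_le hφ hs
  exact (memLp_one_iff_integrable.1 hu).mul_bdd
    (continuous_caputoDivergence hφ hs.2).aestronglyMeasurable (Eventually.of_forall hB)

theorem integral_mul_fracDivergence_eq (u : (Fin N → ℝ) → ℝ)
    {φ : TensorField N 1} (hφ : ∀ J, IsTestFunction (φ J)) {s : ℝ} (hs : s < 1) :
    ∫ x, u x * fracDivergence s φ x ∂(cubeMeasure N) =
      ∫ x, u x * caputoDivergence s φ x ∂(cubeMeasure N) :=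
  setIntegral_congr_fun measurableSet_cube fun x hx => by
    simp only [fracDivergence_eq_caputoDivergence hφ hs hx]

/-- The pairing of `u` with the fractional divergence is linear on test fields. -/
theorem integral_mul_fracDivergence_smul_add {u : (Fin N → ℝ) → ℝ}
    (hu : MemLp u 1 (cubeMeasure N)) {φ ψ : TensorField N 1} (hφ : ∀ J, IsTestFunction (φ J))
    (hψ : ∀ J, IsTestFunction (ψ J)) {s : ℝ} (hs : s ∈ Set.Ioo (0 : ℝ) 1) (c : ℝ) :
    ∫ x, u x * fracDivergence s (c • φ + ψ) x ∂(cubeMeasure N) =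
      c * (∫ x, u x * fracDivergence s φ x ∂(cubeMeasure N)) +
        ∫ x, u x * fracDivergence s ψ x ∂(cubeMeasure N) := by
  have hcφ : ∀ J, IsTestFunction ((c • φ) J) := fun J => (hφ J).const_smul c
  rw [integral_mul_fracDivergence_eq u (φ := c • φ + ψ) (fun J => (hcφ J).add (hψ J)) hs.2,
    integral_mul_fracDivergence_eq u hφ hs.2, integral_mul_fracDivergence_eq u hψ hs.2,
    ← integral_const_mul, ← integral_add ((integrable_mul_caputoDivergence hu hφ hs).const_mul c)
      (integrable_mul_caputoDivergence hu hψ hs)]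
  refine integral_congr_ae (Eventually.of_forall fun x => ?_)
  simp only [caputoDivergence_add hcφ hψ hs.2, caputoDivergence_const_smul]
  ring

theorem ofReal_integral_mul_fracDivergence_le {u : (Fin N → ℝ) → ℝ}
    (hu : MemLp u 1 (cubeMeasure N)) {φ : TensorField N 1} (hφ : ∀ J, IsTestFunction (φ J))
    {s : ℝ} (hs : s ∈ Set.Ioo (0 : ℝ) 1) {B : ℝ}
    (hB : ∀ i x, |partialDeriv i (φ fun _ => i) x| ≤ B) :
    ENNReal.ofReal (∫ x, u x * fracDivergence s φ x ∂(cubeMeasure N)) ≤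
      ENNReal.ofReal (N * (B / Real.Gamma (2 - s))) * normL1 u := by
  have hui := memLp_one_iff_integrable.1 hu
  rw [integral_mul_fracDivergence_eq u hφ hs.2, normL1, eLpNorm_one_eq_lintegral_enorm,
    ← lintegral_const_mul' _ _ ENNReal.ofReal_ne_top]
  refine (Real.ofReal_le_enorm _).trans ((enorm_integral_le_lintegral_enorm _).trans
    (lintegral_mono fun x => ?_))
  rw [enorm_mul, mul_comm]
  gcongr
  rw [Real.enorm_eq_ofReal_abs]
  exact ENNReal.ofReal_le_ofReal (abs_caputoDivergence_le hs hB x)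

end FractionalDerivative

/-! ### A fixed bump of integral one. -/

section Weight

/-- A smooth bump on `(0,1)` centred at `1/2`. -/
noncomputable def unitBump : ContDiffBump (1 / 2 : ℝ) where
  rIn := 1 / 8
  rOut := 1 / 4
  rIn_pos := by norm_num
  rIn_lt_rOut := by norm_num

/-- A smooth function supported in `[1/4, 3/4]` with integral one. -/
noncomputable def weight : ℝ → ℝ := unitBump.normed volume

theorem contDiff_weight : ContDiff ℝ (⊤ : ℕ∞) weight := unitBump.contDiff_normed

theorem tsupport_weight : tsupport weight = Set.Icc (1 / 4) (3 / 4) := by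
  rw [weight, ContDiffBump.tsupport_normed_eq, Real.closedBall_eq_Icc]
  norm_num [unitBump]

theorem iteratedDeriv_weight_eq_zero (k : ℕ) {t : ℝ} (ht : t ∉ Set.Icc (1 / 4 : ℝ) (3 / 4)) :
    iteratedDeriv k weight t = 0 := by
  have h : t ∉ Function.support (iteratedFDeriv ℝ k weight) := fun h => ht <| by
    rw [← tsupport_weight]
    exact support_iteratedFDeriv_subset k h
  rw [iteratedDeriv_eq_iteratedFDeriv, Function.notMem_support.1 h]
  rfl

theorem integral_weight : ∫ t in (0 : ℝ)..1, weight t = 1 := by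
  rw [intervalIntegral.integral_of_le zero_le_one, setIntegral_eq_integral_of_forall_compl_eq_zero]
  · exact unitBump.integral_normed
  · intro t ht
    have := iteratedDeriv_weight_eq_zero 0 (t := t) fun h => ht ⟨by linarith [h.1], by linarith [h.2]⟩
    simpa using this

theorem contDiff_iteratedDeriv_weight (k : ℕ) : ContDiff ℝ (⊤ : ℕ∞) (iteratedDeriv k weight) := by
  rw [iteratedDeriv_eq_iterate]
  exact contDiff_weight.iterate_deriv k

theorem exists_iteratedDeriv_weight_le (k : ℕ) : ∃ B > 0, ∀ t, |iteratedDeriv k weight t| ≤ B := by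
  have hs : HasCompactSupport (iteratedDeriv k weight) :=
    HasCompactSupport.intro isCompact_Icc fun t ht => iteratedDeriv_weight_eq_zero k ht
  obtain ⟨B, hB⟩ := hs.exists_bound_of_continuous (contDiff_iteratedDeriv_weight k).continuous
  exact ⟨max B 1, lt_max_of_lt_right one_pos, fun t => (hB t).trans (le_max_left _ _)⟩

end Weight

/-! ### Splitting a test function into an iterated partial derivative and a controlled remainder. -/

section Decomposition

variable {N : ℕ}

theorem contDiff_update_prod (i : Fin N) :
    ContDiff ℝ (⊤ : ℕ∞) fun q : (Fin N → ℝ) × ℝ => Function.update q.1 i q.2 := by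
  refine contDiff_pi.2 fun j => ?_
  rcases eq_or_ne j i with rfl | h
  · simpa only [Function.update_self] using contDiff_snd
  · simp only [Function.update_of_ne h]
    exact (contDiff_apply ℝ ℝ j).comp contDiff_fst

theorem partialDeriv_eq_of_hasDerivAt {f : (Fin N → ℝ) → ℝ} (hf : Differentiable ℝ f) {i : Fin N}
    {x : Fin N → ℝ} {d : ℝ} (h : HasDerivAt (fun t => f (Function.update x i t)) d (x i)) :
    partialDeriv i f x = d := by
  have := (hasDerivAt_update_comp hf i x (x i)).unique h
  rwa [Function.update_eq_self] at this

/-- The integral of `φ` over the section of the unit cube in direction `i`. -/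
noncomputable def lineIntegral (i : Fin N) (φ : (Fin N → ℝ) → ℝ) (x : Fin N → ℝ) : ℝ :=
  ∫ t in (0 : ℝ)..1, φ (Function.update x i t)

/-- Since the mean is constant in `x_i`, `∂_i` acts on the weight alone in `weightedLineIntegral`.
-/
theorem lineIntegral_update (i : Fin N) (φ : (Fin N → ℝ) → ℝ) (x : Fin N → ℝ) (t : ℝ) :
    lineIntegral i φ (Function.update x i t) = lineIntegral i φ x := by
  simp only [lineIntegral, Function.update_idem]

theorem contDiff_lineIntegral {φ : (Fin N → ℝ) → ℝ} (hφ : IsTestFunction φ) (i : Fin N) :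
    ContDiff ℝ (⊤ : ℕ∞) (lineIntegral i φ) :=
  contDiff_intervalIntegral_param (G := fun q => φ (Function.update q.1 i q.2))
    (hφ.1.comp (contDiff_update_prod i)) 0 1

theorem abs_lineIntegral_le {φ : (Fin N → ℝ) → ℝ} {c : ℝ} (hc : ∀ x, |φ x| ≤ c) (i : Fin N)
    (x : Fin N → ℝ) : |lineIntegral i φ x| ≤ c := by
  have := intervalIntegral.norm_integral_le_of_norm_le_const (a := 0) (b := 1)
    (f := fun t => φ (Function.update x i t)) fun t _ => hc _
  simpa [lineIntegral] using this

/-- The product of a derivative of the weight in the variable `x_i` with the integral of `φ` over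
that variable. -/
noncomputable def weightedLineIntegral (k : ℕ) (i : Fin N) (φ : (Fin N → ℝ) → ℝ)
    (x : Fin N → ℝ) : ℝ :=
  iteratedDeriv k weight (x i) * lineIntegral i φ x

/-- The weight provides the compact support in `x_i` (whence the `1/4`), and `φ` provides it in the
other variables. -/
theorem IsTestFunction.weightedLineIntegral {φ : (Fin N → ℝ) → ℝ} (hφ : IsTestFunction φ) (k : ℕ)
    (i : Fin N) : IsTestFunction (weightedLineIntegral k i φ) := by
  obtain ⟨h1, ε, hε, h⟩ := isTestFunction_iff.1 hφ
  refine isTestFunction_iff.2 ⟨?_, min ε (1 / 4), lt_min hε (by norm_num), fun x hx j => ?_⟩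
  · exact ((contDiff_iteratedDeriv_weight k).comp (contDiff_apply ℝ ℝ i)).mul
      (contDiff_lineIntegral hφ i)
  · rcases eq_or_ne j i with rfl | hj
    · by_contra hn
      refine hx ?_
      rw [RealOrderTV.weightedLineIntegral, iteratedDeriv_weight_eq_zero k, zero_mul]
      exact fun h => hn ⟨(min_le_right _ _).trans h.1, by linarith [h.2, min_le_right ε (1 / 4)]⟩
    · by_contra hn
      refine hx ?_
      have h0 : ∀ t, φ (Function.update x i t) = 0 := fun t => by
        by_contra ht
        have := h _ ht j
        rw [Function.update_of_ne hj] at this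
        exact hn ⟨(min_le_left _ _).trans this.1, by linarith [this.2, min_le_left ε (1 / 4)]⟩
      simp [RealOrderTV.weightedLineIntegral, lineIntegral, h0]

theorem partialDeriv_weightedLineIntegral {φ : (Fin N → ℝ) → ℝ} (hφ : IsTestFunction φ) (k : ℕ)
    (i : Fin N) :
    partialDeriv i (weightedLineIntegral k i φ) = weightedLineIntegral (k + 1) i φ := by
  ext x
  refine partialDeriv_eq_of_hasDerivAt (hφ.weightedLineIntegral k i).differentiable ?_
  simp only [weightedLineIntegral, lineIntegral_update, Function.update_self, iteratedDeriv_succ]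
  exact ((contDiff_iteratedDeriv_weight k).differentiable (by simp) _).hasDerivAt.mul_const _

theorem iterate_partialDeriv_weightedLineIntegral {φ : (Fin N → ℝ) → ℝ} (hφ : IsTestFunction φ)
    (k : ℕ) (i : Fin N) :
    (partialDeriv i)^[k] (weightedLineIntegral 0 i φ) = weightedLineIntegral k i φ := by
  induction k with
  | zero => rfl
  | succ k ih => rw [Function.iterate_succ_apply', ih, partialDeriv_weightedLineIntegral hφ]

/-- The compactly supported antiderivative in the variable `x_i` of `φ` corrected by a multiple of
the weight to have mean zero in that variable. -/
noncomputable def antiderivative (i : Fin N) (φ : (Fin N → ℝ) → ℝ) (x : Fin N → ℝ) : ℝ :=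
  ∫ t in (0 : ℝ)..x i, (φ (Function.update x i t) - weight t * lineIntegral i φ x)

theorem contDiff_antiderivative {φ : (Fin N → ℝ) → ℝ} (hφ : IsTestFunction φ) (i : Fin N) :
    ContDiff ℝ (⊤ : ℕ∞) (antiderivative i φ) := by
  -- Rescaling `t = x_i τ` moves `x_i` from the limit of integration into the integrand.
  have h : antiderivative i φ = fun x => x i * ∫ τ in (0 : ℝ)..1,
      (φ (Function.update x i (x i * τ)) - weight (x i * τ) * lineIntegral i φ x) := by
    ext x
    have := intervalIntegral.mul_integral_comp_mul_left (a := 0) (b := 1)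
      (f := fun t => φ (Function.update x i t) - weight t * lineIntegral i φ x) (x i)
    rw [mul_zero, mul_one] at this
    exact this.symm
  have hi : ContDiff ℝ (⊤ : ℕ∞) fun q : (Fin N → ℝ) × ℝ => q.1 i * q.2 :=
    ((contDiff_apply ℝ ℝ i).comp contDiff_fst).mul contDiff_snd
  rw [h]
  refine (contDiff_apply ℝ ℝ i).mul (contDiff_intervalIntegral_param
    (G := fun q : (Fin N → ℝ) × ℝ => φ (Function.update q.1 i (q.1 i * q.2)) -
      weight (q.1 i * q.2) * lineIntegral i φ q.1) ?_ 0 1)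
  exact (hφ.1.comp ((contDiff_update_prod i).comp (contDiff_fst.prodMk hi))).sub
    ((contDiff_weight.comp hi).mul ((contDiff_lineIntegral hφ i).comp contDiff_fst))

theorem continuous_antiderivative_integrand {φ : (Fin N → ℝ) → ℝ} (hφ : IsTestFunction φ)
    (i : Fin N) (x : Fin N → ℝ) :
    Continuous fun t => φ (Function.update x i t) - weight t * lineIntegral i φ x :=
  (hφ.1.continuous.comp (continuous_const.update i continuous_id)).sub
    (contDiff_weight.continuous.mul continuous_const)

/-- In `x_i`, the integrand vanishes outside `[δ, 1 - δ]`. To the left the integral is therefore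
zero, and to the right it equals the integral over `(0,1)`, which is zero because the weight has
integral one. -/
theorem IsTestFunction.antiderivative {φ : (Fin N → ℝ) → ℝ} (hφ : IsTestFunction φ) (i : Fin N) :
    IsTestFunction (antiderivative i φ) := by
  obtain ⟨h1, ε, hε, h⟩ := isTestFunction_iff.1 hφ
  set δ := min ε (1 / 4) with hδ
  have hδ0 : 0 < δ := lt_min hε (by norm_num)
  have hδε : δ ≤ ε := min_le_left _ _
  have hδ4 : δ ≤ 1 / 4 := min_le_right _ _
  refine isTestFunction_iff.2 ⟨contDiff_antiderivative hφ i, δ, hδ0, fun x hx j => ?_⟩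
  by_contra hn
  refine hx ?_
  rcases eq_or_ne j i with rfl | hj
  · have h0 : ∀ t ∉ Set.Icc δ (1 - δ),
        φ (Function.update x j t) - weight t * lineIntegral j φ x = 0 := fun t ht => by
      have hw := iteratedDeriv_weight_eq_zero 0 (t := t)
        fun hm => ht ⟨by linarith [hm.1], by linarith [hm.2]⟩
      rw [iteratedDeriv_zero] at hw
      rw [hw, zero_mul, sub_zero]
      by_contra hp
      have := h _ hp j
      rw [Function.update_self] at this
      exact ht ⟨hδε.trans this.1, by linarith [this.2]⟩
    have hzero : ∀ a b : ℝ, (∀ t ∈ Set.uIcc a b, t ∉ Set.Icc δ (1 - δ)) →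
        ∫ t in a..b, (φ (Function.update x j t) - weight t * lineIntegral j φ x) = 0 := by
      intro a b hab
      rw [intervalIntegral.integral_congr (g := fun _ => 0) fun t ht => h0 t (hab t ht),
        intervalIntegral.integral_zero]
    have hcont := continuous_antiderivative_integrand hφ j x
    rcases lt_or_ge (x j) δ with hlt | hge
    · exact hzero _ _ fun t ht hm => (ht.2.trans_lt (max_lt hδ0 hlt)).not_ge hm.1
    · have hgt : 1 - δ < x j := not_le.1 fun hle => hn ⟨hge, hle⟩
      rw [RealOrderTV.antiderivative, ← intervalIntegral.integral_add_adjacent_intervals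
        (hcont.intervalIntegrable 0 1) (hcont.intervalIntegrable 1 (x j)),
        hzero 1 (x j) fun t ht hm =>
          ((lt_min (by linarith) hgt).trans_le ht.1).not_ge hm.2, add_zero,
        intervalIntegral.integral_sub, intervalIntegral.integral_mul_const, integral_weight,
        one_mul, lineIntegral, sub_self]
      · exact (hφ.1.continuous.comp (continuous_const.update j continuous_id)).intervalIntegrable _ _
      · exact (contDiff_weight.continuous.mul continuous_const).intervalIntegrable _ _
  · have h0 : ∀ t, φ (Function.update x i t) = 0 := fun t => by
      by_contra ht
      have := h _ ht j
      rw [Function.update_of_ne hj] at this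
      exact hn ⟨hδε.trans this.1, by linarith [this.2]⟩
    simp [RealOrderTV.antiderivative, lineIntegral, h0]

theorem partialDeriv_antiderivative_add {φ : (Fin N → ℝ) → ℝ} (hφ : IsTestFunction φ)
    (i : Fin N) :
    partialDeriv i (antiderivative i φ) + weightedLineIntegral 0 i φ = φ := by
  ext x
  have h : partialDeriv i (antiderivative i φ) x = φ x - weight (x i) * lineIntegral i φ x := by
    refine partialDeriv_eq_of_hasDerivAt (hφ.antiderivative i).differentiable ?_
    simp only [antiderivative, lineIntegral_update, Function.update_self, Function.update_idem]
    have := (continuous_antiderivative_integrand hφ i x).integral_hasStrictDerivAt 0 (x i)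
    simpa only [Function.update_eq_self] using this.hasDerivAt
  simp [h, weightedLineIntegral]

theorem abs_antiderivative_le {φ : (Fin N → ℝ) → ℝ} (hφ : IsTestFunction φ) {c K : ℝ}
    (hc : ∀ x, |φ x| ≤ c) (hK : ∀ t, |weight t| ≤ K) (i : Fin N) (x : Fin N → ℝ) :
    |antiderivative i φ x| ≤ (1 + K) * c := by
  have hc0 : 0 ≤ c := (abs_nonneg _).trans (hc 0)
  have hK0 : 0 ≤ K := (abs_nonneg _).trans (hK 0)
  -- Where the antiderivative is nonzero, `x` is in the cube, so the interval of integration has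
  -- length below one.
  by_cases hx : antiderivative i φ x = 0
  · rw [hx, abs_zero]
    positivity
  have hxc : x ∈ cube N := by
    by_contra h
    exact hx ((hφ.antiderivative i).eq_zero_of_not_mem h)
  have hxi : x i ∈ Set.Ioo (0 : ℝ) 1 := hxc i (Set.mem_univ i)
  have := intervalIntegral.norm_integral_le_of_norm_le_const (a := 0) (b := x i)
    (f := fun t => φ (Function.update x i t) - weight t * lineIntegral i φ x)
    (C := (1 + K) * c) fun t _ => by
      rw [Real.norm_eq_abs]
      have h1 := abs_sub (φ (Function.update x i t)) (weight t * lineIntegral i φ x)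
      rw [abs_mul] at h1
      have h2 := mul_le_mul (hK t) (abs_lineIntegral_le hc i x) (abs_nonneg _) hK0
      linarith [hc (Function.update x i t)]
  refine this.trans ?_
  rw [sub_zero, abs_of_pos hxi.1]
  exact mul_le_of_le_one_right (by positivity) hxi.2.le

/-- Every test function is the sum of an `m`-th partial derivative in direction `i` of a bounded test
function and of a test function whose partial derivative in direction `i` is bounded. -/
theorem exists_eq_iterate_partialDeriv_add (m : ℕ) :
    ∃ A > (0 : ℝ), ∃ B > (0 : ℝ), ∀ {N : ℕ} (i : Fin N) (φ : (Fin N → ℝ) → ℝ),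
      IsTestFunction φ → (∀ x, |φ x| ≤ 1) →
      ∃ ψ ρ : (Fin N → ℝ) → ℝ, IsTestFunction ψ ∧ IsTestFunction ρ ∧ (∀ x, |ψ x| ≤ A) ∧
        (∀ x, |partialDeriv i ρ x| ≤ B) ∧ φ = (partialDeriv i)^[m] ψ + ρ := by
  induction m with
  | zero =>
    refine ⟨1, one_pos, 1, one_pos, fun i φ hφ hc => ⟨φ, 0, hφ, isTestFunction_zero, hc, ?_, ?_⟩⟩
    · simp [partialDeriv_zero]
    · simp
  | succ m ih =>
    obtain ⟨A, hA, B, hB, ih⟩ := ih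
    obtain ⟨K, hK, hwK⟩ := exists_iteratedDeriv_weight_le 0
    obtain ⟨L, hL, hwL⟩ := exists_iteratedDeriv_weight_le (m + 1)
    -- Split `ψ` as `∂_i` of its antiderivative plus the weighted mean. The mean contributes `∂_i^m`
    -- of itself to the remainder; one more `∂_i` puts `m + 1` derivatives on the weight, whence `L
    -- * A`.
    refine ⟨(1 + K) * A, by positivity, L * A + B, by positivity, fun i φ hφ hc => ?_⟩
    obtain ⟨ψ, ρ, hψ, hρ, hψA, hρB, hdec⟩ := ih i φ hφ hc
    refine ⟨antiderivative i ψ, weightedLineIntegral m i ψ + ρ, hψ.antiderivative i,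
      (hψ.weightedLineIntegral m i).add hρ, ?_, fun x => ?_, ?_⟩
    · exact abs_antiderivative_le hψ hψA (by simpa using hwK) i
    · rw [partialDeriv_add i (hψ.weightedLineIntegral m i) hρ,
        partialDeriv_weightedLineIntegral hψ, Pi.add_apply]
      refine (abs_add_le _ _).trans (add_le_add ?_ (hρB x))
      rw [weightedLineIntegral, abs_mul]
      exact mul_le_mul (hwL _) (abs_lineIntegral_le hψA i x) (abs_nonneg _) hL.le
    · rw [← add_assoc, ← iterate_partialDeriv_weightedLineIntegral hψ, Function.iterate_succ_apply,
        ← iterate_partialDeriv_add i ((hψ.antiderivative i).partialDeriv i)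
          (hψ.weightedLineIntegral 0 i), partialDeriv_antiderivative_add hψ]
      exact hdec

end Decomposition

/-! ### Diagonal tensors as competitors for the higher-order variation. -/

section DiagonalTensor

variable {N : ℕ}

open Classical in
/-- The tensor field with entries `ψ_i` at the constant multi-indices `(i,…,i)` and zero elsewhere. -/
noncomputable def diagonalTensor (k : ℕ) (ψ : Fin N → (Fin N → ℝ) → ℝ) : TensorField N (k + 1) :=
  fun J => if ∀ a, J a = J 0 then ψ (J 0) else 0

theorem forall_snoc_eq_iff {k : ℕ} (J : Fin (k + 1) → Fin N) (i : Fin N) :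
    (∀ a, Fin.snoc (α := fun _ => Fin N) J i a = Fin.snoc (α := fun _ => Fin N) J i 0) ↔
      (∀ a, J a = J 0) ∧ i = J 0 := by
  have h0 : Fin.snoc (α := fun _ => Fin N) J i 0 = J 0 :=
    Fin.snoc_castSucc (α := fun _ => Fin N) i J 0
  rw [h0, Fin.forall_fin_succ']
  simp only [Fin.snoc_castSucc, Fin.snoc_last]

/-- Each row has at most one nonzero entry, in position `J 0`. Both the divergence and the norm
computation rest on this. -/
theorem diagonalTensor_snoc {k : ℕ} (ψ : Fin N → (Fin N → ℝ) → ℝ) (J : Fin (k + 1) → Fin N) :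
    (fun i => diagonalTensor (k + 1) ψ (Fin.snoc (α := fun _ => Fin N) J i)) =
      Pi.single (J 0) (diagonalTensor k ψ J) := by
  have h0 : ∀ i, Fin.snoc (α := fun _ => Fin N) J i 0 = J 0 := fun i =>
    Fin.snoc_castSucc (α := fun _ => Fin N) i J 0
  ext i : 1
  have hiff := forall_snoc_eq_iff J i
  rw [h0] at hiff
  simp only [diagonalTensor, h0, hiff]
  rcases eq_or_ne i (J 0) with rfl | h
  · simp
  · simp [h]

theorem isTestFunction_diagonalTensor {k : ℕ} {ψ : Fin N → (Fin N → ℝ) → ℝ}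
    (hψ : ∀ i, IsTestFunction (ψ i)) (J : Fin (k + 1) → Fin N) :
    IsTestFunction (diagonalTensor k ψ J) := by
  unfold diagonalTensor
  split_ifs
  exacts [hψ _, isTestFunction_zero]

theorem divergence_diagonalTensor {k : ℕ} (ψ : Fin N → (Fin N → ℝ) → ℝ) :
    divergence (diagonalTensor (k + 1) ψ) = diagonalTensor k fun i => partialDeriv i (ψ i) := by
  ext J x
  have h : ∀ i, diagonalTensor (k + 1) ψ (Fin.snoc (α := fun _ => Fin N) J i) =
      (Pi.single (J 0) (diagonalTensor k ψ J) : Fin N → (Fin N → ℝ) → ℝ) i :=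
    congrFun (diagonalTensor_snoc ψ J)
  simp only [divergence, h]
  rw [Finset.sum_eq_single (J 0)]
  · simp only [Pi.single_eq_same, diagonalTensor]
    split_ifs
    · rfl
    · simp
  · intro i _ hi
    simp [Pi.single_eq_of_ne hi]
  · simp

theorem iterDivergence_diagonalTensor (k : ℕ) (ψ : Fin N → (Fin N → ℝ) → ℝ) :
    iterDivergence k (diagonalTensor k ψ) = fun J => (partialDeriv (J 0))^[k] (ψ (J 0)) := by
  induction k generalizing ψ with
  | zero =>
    funext J
    have h : ∀ a, J a = J 0 := fun a => congrArg J (Fin.fin_one_eq_zero a)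
    simp [iterDivergence, diagonalTensor, h]
  | succ k ih => rw [iterDivergence, divergence_diagonalTensor, ih]; rfl

/-- All `ℓ^q` norms agree on a vector with a single nonzero entry, so `p` plays no role. The order
`k + 1` is essential: at order zero the only row is the full vector `(ψ_i)`. -/
theorem isAdmissible_diagonalTensor {p : ℝ≥0∞} {k : ℕ} {ψ : Fin N → (Fin N → ℝ) → ℝ}
    (hψ : ∀ i, IsTestFunction (ψ i)) (h1 : ∀ i x, |ψ i x| ≤ 1) :
    IsAdmissible p (k + 1) (diagonalTensor (k + 1) ψ) := by
  refine ⟨isTestFunction_diagonalTensor hψ, fun J x => ?_⟩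
  -- `conjExponent` is defined as `1 + (p - 1)⁻¹`.
  have : Fact (1 ≤ p.conjExponent) := ⟨le_self_add⟩
  have h : (fun i => diagonalTensor (k + 1) ψ (Fin.snoc (α := fun _ => Fin N) J i) x) =
      Pi.single (J 0) (diagonalTensor k ψ J x) := by
    ext i
    rw [congrFun (diagonalTensor_snoc ψ J) i]
    rcases eq_or_ne i (J 0) with rfl | hi
    · simp
    · simp [Pi.single_eq_of_ne hi]
  rw [h]
  refine (PiLp.norm_single p.conjExponent (fun _ : Fin N => ℝ) (J 0) _).trans_le ?_
  rw [Real.norm_eq_abs]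
  unfold diagonalTensor
  split_ifs
  · exact h1 _ x
  · simp

theorem IsAdmissible.abs_le_one {p : ℝ≥0∞} {φ : TensorField N 1} (hφ : IsAdmissible p 0 φ)
    (i : Fin N) (x : Fin N → ℝ) : |φ (fun _ => i) x| ≤ 1 := by
  have : Fact (1 ≤ p.conjExponent) := ⟨le_self_add⟩
  have h := (PiLp.norm_apply_le (WithLp.toLp p.conjExponent fun i : Fin N =>
    φ (Fin.snoc (α := fun _ => Fin N) (default : Fin 0 → Fin N) i) x) i).trans (hφ.2 default x)
  have hs : Fin.snoc (α := fun _ => Fin N) (default : Fin 0 → Fin N) i = fun _ => i := by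
    funext a
    rw [Fin.fin_one_eq_zero a]
    exact Fin.snoc_last (n := 0) (α := fun _ => Fin N) i default
  simpa only [hs, Real.norm_eq_abs] using h

end DiagonalTensor

/-! ### The estimate for a positive integer part, and the theorem. -/

section Main

theorem exists_variation_zero_le (N k : ℕ) :
    ∃ C > (0 : ℝ), ∀ s ∈ Set.Ioo (0 : ℝ) 1, ∀ (p : ℝ≥0∞) (u : (Fin N → ℝ) → ℝ),
      MemLp u 1 (cubeMeasure N) →
        variation p 0 s u ≤ ENNReal.ofReal C * (normL1 u + variation p (k + 1) s u) := by
  obtain ⟨A, hA, B, hB, hdec⟩ := exists_eq_iterate_partialDeriv_add (k + 1)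
  obtain ⟨K, hK, hΓ⟩ := exists_one_div_Gamma_le
  -- `A` pays for normalizing the diagonal competitor, `N * (B * K)` for the remainder paired with
  -- `u`.
  refine ⟨max A (N * (B * K)), lt_max_of_lt_left hA, fun s hs p u hu => ?_⟩
  refine iSup₂_le fun φ hφ => ?_
  choose ψ ρ hψ hρ hψA hρB heq using fun i : Fin N =>
    hdec i (φ fun _ => i) (hφ.1 _) (hφ.abs_le_one i)
  set χ : Fin N → (Fin N → ℝ) → ℝ := fun i => A⁻¹ • ψ i with hχ
  have hχt : ∀ i, IsTestFunction (χ i) := fun i => (hψ i).const_smul _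
  have hadm : IsAdmissible p (k + 1) (diagonalTensor (k + 1) χ) := by
    refine isAdmissible_diagonalTensor hχt fun i x => ?_
    simp only [hχ, Pi.smul_apply, smul_eq_mul]
    rw [abs_mul, abs_of_pos (inv_pos.2 hA)]
    exact (inv_mul_le_iff₀ hA).2 (by simpa using hψA i x)
  have hdiv := iterDivergence_diagonalTensor (k + 1) χ
  have hdivt : ∀ J, IsTestFunction (iterDivergence (k + 1) (diagonalTensor (k + 1) χ) J) := by
    intro J
    rw [hdiv]
    exact (hχt _).iterate_partialDeriv _ _
  have hφeq : φ = A • iterDivergence (k + 1) (diagonalTensor (k + 1) χ) +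
      (fun J => ρ (J 0) : TensorField N 1) := by
    funext J
    have hJ : J = fun _ => J 0 := funext fun a => congrArg J (Fin.fin_one_eq_zero a)
    have h1 := heq (J 0)
    rw [← hJ] at h1
    rw [h1, hdiv, Pi.add_apply, Pi.smul_apply]
    simp only [hχ, iterate_partialDeriv_const_smul, smul_smul, mul_inv_cancel₀ hA.ne', one_smul]
  have hlin := integral_mul_fracDivergence_smul_add hu hdivt
    (ψ := fun J => ρ (J 0)) (fun J => hρ _) hs A
  rw [← hφeq] at hlin
  rw [iterDivergence, hlin, mul_add, add_comm (ENNReal.ofReal _ * normL1 u)]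
  refine ENNReal.ofReal_add_le.trans (add_le_add ?_ ?_)
  · rw [ENNReal.ofReal_mul hA.le]
    gcongr
    · exact le_max_left _ _
    · exact le_iSup₂ (f := fun (φ : TensorField N (k + 1 + 1)) (_ : IsAdmissible p (k + 1) φ) =>
        ENNReal.ofReal (∫ x, u x * fracDivergence s (iterDivergence (k + 1) φ) x ∂(cubeMeasure N)))
        _ hadm
  · refine (ofReal_integral_mul_fracDivergence_le hu (fun J => hρ _) hs hρB).trans ?_
    gcongr
    refine le_trans ?_ (le_max_right _ _)
    have := hΓ s hs
    rw [div_eq_mul_one_div B]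
    gcongr

end Main

end RealOrderTV

theorem proposition4p6 (N : ℕ) (hN : 1 ≤ N) (m : ℕ) :
    ∃ C : ℝ, 0 < C ∧
      ∀ r s : ℝ, s ∈ Set.Ioo (0 : ℝ) 1 → r = (m : ℝ) + s →
        ∀ p : ENNReal, 1 ≤ p →
          ∀ u ∈ RealOrderTV.SV N r,
            RealOrderTV.TV p s u ≤
              ENNReal.ofReal C * (RealOrderTV.normL1 u + RealOrderTV.TV p r u) := by
  cases m with
  | zero =>
    -- Here `r = s`, so the left side already occurs on the right.
    refine ⟨1, one_pos, fun r s _ hr p _ u _ => ?_⟩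
    rw [Nat.cast_zero, zero_add] at hr
    rw [hr, ENNReal.ofReal_one, one_mul]
    exact le_add_self
  | succ k =>
    obtain ⟨C, hC, h⟩ := RealOrderTV.exists_variation_zero_le N k
    refine ⟨C, hC, fun r s hs hr p hp u hu => ?_⟩
    obtain ⟨v, -, hv⟩ := hu p hp
    have hfloor : ⌊s⌋₊ = 0 := Nat.floor_eq_zero.2 hs.2
    have hfract : Int.fract s = s := Int.fract_eq_self.2 ⟨hs.1.le, hs.2⟩
    rw [RealOrderTV.TV, RealOrderTV.TV, hr, add_comm (_ : ℝ) s, Nat.floor_add_natCast hs.1.le,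
      Int.fract_add_natCast, hfloor, hfract, zero_add]
    exact h s hs p u hv.2.1
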